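/- Rings are associative with $1$, not necessarily commutative, and multiplicative sets are submonoids that do not contain $0$. For a ring $R$, $\min(R)$ is the set of its minimal prime ideals, and $R$ is semiprime if the intersection of all its prime ideals is $0$. A left Ore set is a multiplicative set $S$ with $Sr\cap Rs\neq\emptyset$ for all $r\in R$, $s\in S$; put $\mathrm{ass}_l(S)=\{r\in R \mid sr=0 \text{ for some } s\in S\}$. A left Ore set $S$ is a left denominator set if $rs=0$ with $r\in R$, $s\in S$ implies $r\in\mathrm{ass}_l(S)$. $\mathrm{Den}_l(R,\mathfrak a)$ is the set of left denominator sets $S$ of $R$ with $\mathrm{ass}_l(S)=\mathfrak a$. $S_l(R)$ is the largest element of $\mathrm{Den}_l(R,0)$ with respect to inclusion (it exists for $R\ne 0$), and $Q_l(R)=S_l(R)^{-1}R$ is the largest left quotient ring of $R$. For an ideal $\mathfrak p$ of $R$, $\pi_{\mathfrak p}:R\to R/\mathfrak p$ is the canonical map and $S_l(R)^{-1}\mathfrak p=\{s^{-1}a\mid s\in S_l(R),\ a\in\mathfrak p\}\subseteq Q_l(R)$. Let $R$ be a nonzero semiprime ring. Then: 1. The ring $Q_l(R)$ is semiprime. 2.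 If, in addition, $\min(R)$ is finite, then (a) $\min(Q_l(R))=\{S_l(R)^{-1}\mathfrak p \mid \mathfrak p\in\min(R)\}$. (b) For all $\mathfrak p\in\min(R)$: $\pi_{\mathfrak p}(S_l(R))\in\mathrm{Den}_l(R/\mathfrak p,0)$, $S_l(R)^{-1}\mathfrak p$ is a two-sided ideal of $Q_l(R)$, and there are canonical isomorphisms $$\pi_{\mathfrak p}(S_l(R))^{-1}(R/\mathfrak p)\simeq Q_l(R)/S_l(R)^{-1}\mathfrak p\simeq S_l(R)^{-1}(R/\mathfrak p),$$ the first one of rings, $s^{-1}r+S_l(R)^{-1}\mathfrak p\mapsto \pi_{\mathfrak p}(s)^{-1}\pi_{\mathfrak p}(r)$, the second one of left $Q_l(R)$-modules, $s^{-1}r+S_l(R)^{-1}\mathfrak p\mapsto s^{-1}\pi_{\mathfrak p}(r)$, where $S_l(R)^{-1}(R/\mathfrak p)$ is the localization of the left $R$-module $R/\mathfrak p$. (c) For all $\mathfrak p\in\min(R)$: $\pi_{\mathfrak p}(S_l(R))\subseteq S_l(R/\mathfrak p)$, and $s^{-1}r+S_l(R)^{-1}\mathfrak p\mapsto\pi_{\mathfrak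 p}(s)^{-1}\pi_{\mathfrak p}(r)$ is a well-defined injective ring homomorphism $Q_l(R)/S_l(R)^{-1}\mathfrak p\to Q_l(R/\mathfrak p)$. -/

import Mathlib

namespace LargestLeft

universe u

/-- A prime ideal of a (not necessarily commutative) ring: a proper two-sided ideal `P` such that
`I * J ≤ P` implies `I ≤ P` or `J ≤ P` for all two-sided ideals `I`, `J`.
(`Ideal R` is Mathlib's type of left ideals; `Ideal.IsTwoSided` is right absorption.) -/
structure IsPrimeIdeal {R : Type u} [Ring R] (P : Ideal R) : Prop where
  isTwoSided : P.IsTwoSided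
  ne_top : P ≠ ⊤
  le_or_le : ∀ I J : Ideal R, I.IsTwoSided → J.IsTwoSided → I * J ≤ P → I ≤ P ∨ J ≤ P

/-- The prime spectrum of `R`. -/
def spec (R : Type u) [Ring R] : Set (Ideal R) := {P | IsPrimeIdeal P}

/-- The set of minimal prime ideals of `R`. -/
def minPrimes (R : Type u) [Ring R] : Set (Ideal R) := {P | Minimal (· ∈ spec R) P}

/-- A ring is semiprime if its prime radical (the intersection of all primes) is zero. -/
def IsSemiprimeRing (R : Type u) [Ring R] : Prop := sInf (spec R) = ⊥

/-- `ass_l(S)`, the set of elements that are killed from the left by an element of `S`. -/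
def leftAss {R : Type u} [Ring R] (S : Submonoid R) : Set R := {r | ∃ s ∈ S, s * r = 0}

/-- Left Ore sets: `0 ∉ S` and `S r ∩ R s ≠ ∅` for all `r ∈ R` and `s ∈ S`. -/
structure IsLeftOreSet {R : Type u} [Ring R] (S : Submonoid R) : Prop where
  zero_notMem : (0 : R) ∉ S
  ore : ∀ r : R, ∀ s ∈ S, ∃ t ∈ S, ∃ r' : R, t * r = r' * s

/-- Left denominator sets: left Ore sets such that `r s = 0` with `s ∈ S` implies
`r ∈ ass_l(S)`. -/
structure IsLeftDenominatorSet {R : Type u} [Ring R] (S : Submonoid R) : Prop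
    extends IsLeftOreSet S where
  reversible : ∀ r : R, ∀ s ∈ S, r * s = 0 → r ∈ leftAss S

/-- `Den_l(R, 𝔞)`: the left denominator sets `S` of `R` with `ass_l(S) = 𝔞`. -/
def leftDen (R : Type u) [Ring R] (𝔞 : Ideal R) : Set (Submonoid R) :=
  {S | IsLeftDenominatorSet S ∧ leftAss S = (𝔞 : Set R)}

/-- A left denominator set is an Ore set in the sense of Mathlib, so that the left localization
`OreLocalization S R` is available. -/
@[reducible]
noncomputable def IsLeftDenominatorSet.oreSet {R : Type u} [Ring R] {S : Submonoid R}
    (h : IsLeftDenominatorSet S) : OreLocalization.OreSet S :=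
  Classical.choice <| OreLocalization.nonempty_oreSet_iff.2
    ⟨fun r₁ r₂ s hs => by
      obtain ⟨t, ht, h0⟩ := h.reversible (r₁ - r₂) s s.2 (by rw [sub_mul, hs, sub_self])
      exact ⟨⟨t, ht⟩, by rwa [mul_sub, sub_eq_zero] at h0⟩,
    fun r s => by
      obtain ⟨t, ht, r', e⟩ := h.ore r s s.2
      exact ⟨r', ⟨t, ht⟩, e⟩⟩

/-- `S_l(R)`, the largest element of `Den_l(R, 0)` with respect to inclusion
(see `isGreatest_largestLeftDen`), constructed as the supremum of `Den_l(R, 0)`. -/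
def largestLeftDen (R : Type u) [Ring R] : Submonoid R := sSup (leftDen R ⊥)

theorem largestLeftDen_induction {R : Type u} [Ring R] {p : R → Prop}
    (mem : ∀ S ∈ leftDen R ⊥, ∀ s ∈ S, p s) (one : p 1)
    (mul : ∀ x y, p x → p y → p (x * y)) {s : R} (hs : s ∈ largestLeftDen R) : p s := by
  let T : Submonoid R := ⟨⟨{x | p x}, fun {a b} => mul a b⟩, one⟩
  have hT : largestLeftDen R ≤ T := sSup_le fun S hS s hs => mem S hS s hs
  exact hT hs

theorem mul_left_eq_zero_of_mem {R : Type u} [Ring R] {s : R} (hs : s ∈ largestLeftDen R) :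
    ∀ r : R, s * r = 0 → r = 0 := by
  refine largestLeftDen_induction (p := fun s => ∀ r : R, s * r = 0 → r = 0) ?_ (by simp) ?_ hs
  · intro S hS s hs r h
    have : r ∈ leftAss S := ⟨s, hs, h⟩
    rw [hS.2] at this
    simpa using this
  · intro x y hx hy r h
    exact hy r (hx _ (by rwa [← mul_assoc]))

theorem mul_right_eq_zero_of_mem {R : Type u} [Ring R] {s : R} (hs : s ∈ largestLeftDen R) :
    ∀ r : R, r * s = 0 → r = 0 := by
  refine largestLeftDen_induction (p := fun s => ∀ r : R, r * s = 0 → r = 0) ?_ (by simp) ?_ hs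
  · intro S hS s hs r h
    have : r ∈ leftAss S := hS.1.reversible r s hs h
    rw [hS.2] at this
    simpa using this
  · intro x y hx hy r h
    exact hx r (hy _ (by rwa [mul_assoc]))

theorem largestLeftDen_ore {R : Type u} [Ring R] {s : R} (hs : s ∈ largestLeftDen R) :
    ∀ r : R, ∃ t ∈ largestLeftDen R, ∃ r' : R, t * r = r' * s := by
  refine largestLeftDen_induction
    (p := fun s => ∀ r : R, ∃ t ∈ largestLeftDen R, ∃ r' : R, t * r = r' * s) ?_ ?_ ?_ hs
  · intro S hS s hs r
    obtain ⟨t, ht, r', e⟩ := hS.1.ore r s hs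
    exact ⟨t, le_sSup (a := S) hS ht, r', e⟩
  · exact fun r => ⟨1, one_mem _, r, by simp⟩
  · intro x y hx hy r
    obtain ⟨t, ht, r', e⟩ := hy r
    obtain ⟨t', ht', r'', e'⟩ := hx r'
    exact ⟨t' * t, mul_mem ht' ht, r'', by rw [mul_assoc, e, ← mul_assoc, e', mul_assoc]⟩

theorem isGreatest_largestLeftDen (R : Type u) [Ring R] [Nontrivial R] :
    IsGreatest (leftDen R ⊥) (largestLeftDen R) := by
  refine ⟨⟨⟨⟨fun h => ?_, fun r s hs => largestLeftDen_ore hs r⟩, fun r s hs h => ?_⟩, ?_⟩,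
    fun S hS => le_sSup hS⟩
  · exact one_ne_zero (mul_left_eq_zero_of_mem h 1 (by simp))
  · exact ⟨1, one_mem _, by rw [mul_right_eq_zero_of_mem hs r h, mul_zero]⟩
  · ext r
    constructor
    · rintro ⟨s, hs, h⟩
      simpa using mul_left_eq_zero_of_mem hs r h
    · intro h
      exact ⟨1, one_mem _, by simpa using h⟩

noncomputable instance instOreSetLargestLeftDen (R : Type u) [Ring R] :
    OreLocalization.OreSet (largestLeftDen R) :=
  Classical.choice <| OreLocalization.nonempty_oreSet_iff.2
    ⟨fun r₁ r₂ s hs => ⟨1, by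
      rw [sub_eq_zero.1 (mul_right_eq_zero_of_mem s.2 (r₁ - r₂) (by rw [sub_mul, hs, sub_self]))]⟩,
    fun r s => by
      obtain ⟨t, ht, r', e⟩ := largestLeftDen_ore s.2 r
      exact ⟨r', ⟨t, ht⟩, e⟩⟩

/-- `Q_l(R) = S_l(R)⁻¹R`, the largest left quotient ring of `R`. -/
abbrev LargestLeftQuotientRing (R : Type u) [Ring R] : Type u :=
  OreLocalization (largestLeftDen R) R

/-- `S⁻¹I = {s⁻¹a | s ∈ S, a ∈ I}`, a left ideal of `S⁻¹R`, for a left ideal `I` of `R`. -/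
def localizedIdeal {R : Type u} [Ring R] (S : Submonoid R) [OreLocalization.OreSet S]
    (I : Ideal R) : Ideal (OreLocalization S R) where
  carrier := {x | ∃ a ∈ I, ∃ s : S, x = OreLocalization.oreDiv a s}
  zero_mem' := ⟨0, I.zero_mem, 1, (OreLocalization.zero_oreDiv 1).symm⟩
  add_mem' := by
    rintro _ _ ⟨a, ha, s, rfl⟩ ⟨b, hb, t, rfl⟩
    rw [OreLocalization.oreDiv_add_oreDiv]
    exact ⟨_, I.add_mem (I.smul_of_tower_mem _ ha) (I.mul_mem_left _ hb), _, rfl⟩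
  smul_mem' := by
    rintro c _ ⟨b, hb, t, rfl⟩
    induction c with | _ r s
    rw [OreLocalization.oreDiv_smul_oreDiv]
    exact ⟨_, I.mul_mem_left _ hb, _, rfl⟩

end LargestLeft

open LargestLeft

/-! Elements of S = S_l(R) are regular on both sides. Semiprimeness amounts to the elementwise
condition that aRa = 0 forces a = 0 (`isSemiprimeRing_iff`), and this survives inverting S. If
min(R) is finite, a minimal prime P is both the left and the right annihilator of the intersection
of the other minimal primes. Hence S stays regular modulo P on both sides (`mem_of_mul_mem_left`,
`mem_of_mul_mem_right`). So the image of S in R/P is a left denominator set with zero ass, and S⁻¹P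
is a two-sided prime ideal contracting to P. The finitely many S⁻¹P intersect in 0, so every prime
of Q_l(R) contains one of them, which determines the minimal primes. The ring maps come from the
kernel of `quotientMap`, the module isomorphism from the annihilator of 1/1. -/

namespace LargestLeft

universe u

/-! ### Primes, semiprimeness and minimal primes of noncommutative rings -/

section Primes

variable {R : Type u} [Ring R]

theorem isTwoSided_sup {I J : Ideal R} (hI : I.IsTwoSided) (hJ : J.IsTwoSided) :
    (I ⊔ J).IsTwoSided := by
  refine ⟨fun {a} b ha => ?_⟩
  obtain ⟨x, hx, y, hy, rfl⟩ := Submodule.mem_sup.1 ha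
  rw [add_mul]
  exact Submodule.add_mem_sup (hI.mul_mem_of_left b hx) (hJ.mul_mem_of_left b hy)

theorem isTwoSided_sInf {F : Set (Ideal R)} (hF : ∀ I ∈ F, I.IsTwoSided) :
    (sInf F).IsTwoSided := by
  refine ⟨fun {a} b ha => ?_⟩
  rw [Submodule.mem_sInf] at ha ⊢
  exact fun I hI => (hF I hI).mul_mem_of_left b (ha I hI)

/-- A proper two-sided ideal is prime if `x R y ⊆ P` implies `x ∈ P` or `y ∈ P`. -/
theorem IsPrimeIdeal.of_mem_or_mem {P : Ideal R} (h2 : P.IsTwoSided) (hne : P ≠ ⊤)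
    (h : ∀ x y : R, (∀ r, x * r * y ∈ P) → x ∈ P ∨ y ∈ P) : IsPrimeIdeal P := by
  refine ⟨h2, hne, fun I J hI _ hIJ => ?_⟩
  by_contra! hcon
  obtain ⟨x, hxI, hxP⟩ := SetLike.not_le_iff_exists.1 hcon.1
  obtain ⟨y, hyJ, hyP⟩ := SetLike.not_le_iff_exists.1 hcon.2
  exact (h x y fun r => hIJ (Ideal.mul_mem_mul (hI.mul_mem_of_left r hxI) hyJ)).elim hxP hyP

theorem IsPrimeIdeal.mem_or_mem {P : Ideal R} (hP : IsPrimeIdeal P) {x y : R}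
    (h : ∀ r, x * r * y ∈ P) : x ∈ P ∨ y ∈ P := by
  have h2 := hP.isTwoSided
  -- Annihilators modulo P replace the two-sided ideals generated by y and x: J is the largest set
  -- with xRJ ⊆ P, and I the largest with IRJ ⊆ P.
  let J : Ideal R :=
    { carrier := {z | ∀ r, x * r * z ∈ P}
      zero_mem' := fun r => by simp
      add_mem' := fun {a b} ha hb r => by rw [mul_add]; exact P.add_mem (ha r) (hb r)
      smul_mem' := fun c z hz r => by
        simpa only [smul_eq_mul, mul_assoc] using hz (r * c) }
  let I : Ideal R :=
    { carrier := {w | ∀ z ∈ J, ∀ r, w * r * z ∈ P}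
      zero_mem' := fun z _ r => by simp
      add_mem' := fun {a b} ha hb z hz r => by
        rw [add_mul, add_mul]; exact P.add_mem (ha z hz r) (hb z hz r)
      smul_mem' := fun c w hw z hz r => by
        simpa only [smul_eq_mul, mul_assoc] using P.mul_mem_left c (hw z hz r) }
  have hJ : J.IsTwoSided := ⟨fun {a} b ha r => by
    rw [← mul_assoc]; exact h2.mul_mem_of_left b (ha r)⟩
  have hI : I.IsTwoSided := ⟨fun {a} b ha z hz r => by
    simpa only [mul_assoc] using ha z hz (b * r)⟩
  have hIJ : I * J ≤ P := Ideal.mul_le.2 fun w hw z hz => by simpa using hw z hz 1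
  exact (hP.le_or_le I J hI hJ hIJ).imp (fun hle => hle (show x ∈ I from fun z hz => hz))
    fun hle => hle (show y ∈ J from h)

theorem IsPrimeIdeal.exists_le_of_sInf_le {P : Ideal R} (hP : IsPrimeIdeal P)
    {F : Set (Ideal R)} (hfin : F.Finite) (hF : ∀ I ∈ F, I.IsTwoSided) (h : sInf F ≤ P) :
    ∃ I ∈ F, I ≤ P := by
  induction F, hfin using Set.Finite.induction_on with
  | empty => exact absurd (top_le_iff.1 (by simpa using h)) hP.ne_top
  | @insert I F _ _ ih =>
    have hF' : ∀ J ∈ F, J.IsTwoSided := fun J hJ => hF J (Set.mem_insert_of_mem I hJ)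
    have hI := hF I (Set.mem_insert I F)
    rw [sInf_insert] at h
    have hmul : I * sInf F ≤ P := Ideal.mul_le.2 fun x hx y hy =>
      h ⟨hI.mul_mem_of_left y hx, Ideal.mul_mem_left _ x hy⟩
    rcases hP.le_or_le I (sInf F) hI (isTwoSided_sInf hF') hmul with h | h
    · exact ⟨I, Set.mem_insert I F, h⟩
    · obtain ⟨J, hJ, hJP⟩ := ih hF' h
      exact ⟨J, Set.mem_insert_of_mem I hJ, hJP⟩

/-- If P misses x and Q misses y, the smaller of the two misses both. -/
theorem IsPrimeIdeal.sInf_of_isChain {C : Set (Ideal R)} (hne : C.Nonempty)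
    (hC : ∀ P ∈ C, IsPrimeIdeal P) (hchain : IsChain (· ≤ ·) C) : IsPrimeIdeal (sInf C) := by
  obtain ⟨P₀, hP₀⟩ := hne
  refine .of_mem_or_mem (isTwoSided_sInf fun P hP => (hC P hP).isTwoSided)
    (fun h => (hC P₀ hP₀).ne_top (top_le_iff.1 (h ▸ sInf_le hP₀))) fun x y h => ?_
  by_contra! hcon
  simp only [Submodule.mem_sInf, not_forall] at hcon h
  obtain ⟨⟨P, hP, hxP⟩, ⟨Q, hQ, hyQ⟩⟩ := hcon
  rcases hchain.total hP hQ with hle | hle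
  · exact ((hC P hP).mem_or_mem fun r => h r P hP).elim hxP fun hy => hyQ (hle hy)
  · exact ((hC Q hQ).mem_or_mem fun r => h r Q hQ).elim (fun hx => hxP (hle hx)) hyQ

theorem IsPrimeIdeal.exists_minPrimes_le {P : Ideal R} (hP : IsPrimeIdeal P) :
    ∃ Q ∈ minPrimes R, Q ≤ P := by
  obtain ⟨Q, hle, hQ⟩ := zorn_le_nonempty₀ (α := (Ideal R)ᵒᵈ) {P | IsPrimeIdeal (OrderDual.ofDual P)}
    (fun C hC hchain y hy => ⟨OrderDual.toDual (sInf (OrderDual.toDual ⁻¹' C)),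
      IsPrimeIdeal.sInf_of_isChain ⟨OrderDual.ofDual y, hy⟩ (fun P hP => hC hP) hchain.symm,
      fun z hz => (sInf_le (show OrderDual.ofDual z ∈ OrderDual.toDual ⁻¹' C from hz) :
        sInf (OrderDual.toDual ⁻¹' C) ≤ OrderDual.ofDual z)⟩) (OrderDual.toDual P) hP
  exact ⟨OrderDual.ofDual Q, ⟨hQ.1, fun J hJ hJQ => hQ.2 (y := OrderDual.toDual J) hJ hJQ⟩, hle⟩

theorem sInf_minPrimes (R : Type u) [Ring R] : sInf (minPrimes R) = sInf (spec R) := by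
  refine le_antisymm (le_sInf fun P hP => ?_) (sInf_le_sInf fun P hP => hP.1)
  obtain ⟨Q, hQ, hle⟩ := IsPrimeIdeal.exists_minPrimes_le hP
  exact (sInf_le hQ).trans hle

theorem eq_of_le_of_mem_minPrimes {P Q : Ideal R} (hP : IsPrimeIdeal P) (hQ : Q ∈ minPrimes R)
    (h : P ≤ Q) : P = Q :=
  le_antisymm h (hQ.2 hP h)

/-- A sequence of nonzero elements with `x (n + 1) ∈ x n * R * x n` misses some prime ideal. -/
theorem exists_isPrimeIdeal_forall_notMem {x : ℕ → R} (h0 : ∀ n, x n ≠ 0)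
    (hx : ∀ n, ∃ r, x (n + 1) = x n * r * x n) : ∃ P, IsPrimeIdeal P ∧ ∀ n, x n ∉ P := by
  have hbound : ∀ C ⊆ {I : Ideal R | I.IsTwoSided ∧ ∀ n, x n ∉ I}, IsChain (· ≤ ·) C →
      ∀ y ∈ C, ∃ ub ∈ {I : Ideal R | I.IsTwoSided ∧ ∀ n, x n ∉ I}, ∀ z ∈ C, z ≤ ub := by
    intro C hC hchain y hy
    refine ⟨sSup C, ⟨⟨fun {a} b ha => ?_⟩, fun n hn => ?_⟩, fun z hz => le_sSup hz⟩
    · obtain ⟨I, hI, haI⟩ := (Submodule.mem_sSup_of_directed ⟨y, hy⟩ hchain.directedOn).1 ha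
      exact le_sSup hI ((hC hI).1.mul_mem_of_left b haI)
    · obtain ⟨I, hI, haI⟩ := (Submodule.mem_sSup_of_directed ⟨y, hy⟩ hchain.directedOn).1 hn
      exact (hC hI).2 n haI
  -- P is maximal among the two-sided ideals avoiding the sequence; maximality makes it prime.
  obtain ⟨P, -, hP⟩ := zorn_le_nonempty₀ _ hbound ⊥
    ⟨⟨fun {a} b ha => by simp_all⟩, fun n => by simpa using h0 n⟩
  -- Membership persists along the sequence, so one index serves both P ⊔ I and P ⊔ J.
  have hmono : ∀ (I : Ideal R) m n, m ≤ n → x m ∈ I → x n ∈ I := fun I m n hmn hm => by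
    induction n, hmn using Nat.le_induction with
    | base => exact hm
    | succ n _ ih =>
      obtain ⟨r, hr⟩ := hx n
      rw [hr]
      exact I.mul_mem_left _ ih
  refine ⟨P, ⟨hP.1.1, fun h => hP.1.2 0 (h ▸ Submodule.mem_top), fun I J hI hJ hIJ => ?_⟩,
    hP.1.2⟩
  have key : ∀ K : Ideal R, K.IsTwoSided → ¬ K ≤ P → ∃ n, x n ∈ P ⊔ K := fun K hK hKP => by
    by_contra! hcon
    exact hKP (le_sup_right.trans (hP.2 ⟨isTwoSided_sup hP.1.1 hK, hcon⟩ le_sup_left))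
  by_contra! hcon
  obtain ⟨m, hm⟩ := key I hI hcon.1
  obtain ⟨n, hn⟩ := key J hJ hcon.2
  obtain ⟨a, ha, b, hb, hab⟩ := Submodule.mem_sup.1 (hmono _ _ _ (le_max_left m n) hm)
  obtain ⟨c, hc, d, hd, hcd⟩ := Submodule.mem_sup.1 (hmono _ _ _ (le_max_right m n) hn)
  obtain ⟨r, hr⟩ := hx (max m n)
  refine hP.1.2 (max m n + 1) ?_
  -- Only b * r * d is not visibly in P, and it lies in I * J.
  have hsplit : x (max m n + 1) = a * (r * (c + d)) + b * r * c + b * r * d := by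
    rw [hr]
    nth_rw 1 [← hab]
    rw [← hcd]
    noncomm_ring
  rw [hsplit]
  exact P.add_mem (P.add_mem (hP.1.1.mul_mem_of_left _ ha) (P.mul_mem_left _ hc))
    (hIJ (Ideal.mul_mem_mul (hI.mul_mem_of_left r hb) hd))

/-- If the condition holds, a nonzero a starts a sequence of nonzero elements, each of the form y *
r * y with y its predecessor; some prime misses this sequence, hence misses a. -/
theorem isSemiprimeRing_iff :
    IsSemiprimeRing R ↔ ∀ a : R, (∀ r, a * r * a = 0) → a = 0 := by
  constructor
  · intro h a ha
    have : a ∈ sInf (spec R) := Submodule.mem_sInf.2 fun P (hP : IsPrimeIdeal P) =>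
      (hP.mem_or_mem (x := a) (y := a) fun r => by simp [ha r]).elim id id
    rw [h] at this
    simpa using this
  · intro h
    refine (Submodule.eq_bot_iff _).2 fun a ha => ?_
    by_contra hne
    have step : ∀ y : {y : R // y ≠ 0}, ∃ r, y.1 * r * y.1 ≠ 0 := fun y => by
      by_contra! hcon
      exact y.2 (h _ hcon)
    choose r hr using step
    let x : ℕ → {y : R // y ≠ 0} :=
      fun n => Nat.rec ⟨a, hne⟩ (fun _ y => ⟨y.1 * r y * y.1, hr y⟩) n
    obtain ⟨P, hP, hxP⟩ := exists_isPrimeIdeal_forall_notMem (x := fun n => (x n).1)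
      (fun n => (x n).2) fun n => ⟨r (x n), rfl⟩
    exact hxP 0 (Submodule.mem_sInf.1 ha P hP)

variable {P : Ideal R}

/-- By finiteness, primeness of P would put a single other minimal prime below P, against
minimality. -/
theorem not_sInf_diff_le (hfin : (minPrimes R).Finite) (hP : P ∈ minPrimes R) :
    ¬ sInf (minPrimes R \ {P}) ≤ P := fun hle => by
  obtain ⟨Q, hQ, hQP⟩ := hP.1.exists_le_of_sInf_le hfin.sdiff
    (fun I hI => hI.1.1.isTwoSided) hle
  exact hQ.2 (eq_of_le_of_mem_minPrimes hQ.1.1 hP hQP)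

theorem eq_zero_of_mem_of_mem_sInf_diff (hR : IsSemiprimeRing R) {x : R} (hx : x ∈ P)
    (hx' : x ∈ sInf (minPrimes R \ {P})) : x = 0 := by
  have : x ∈ sInf (minPrimes R) := Submodule.mem_sInf.2 fun Q hQ => by
    by_cases h : Q = P
    · exact h ▸ hx
    · exact Submodule.mem_sInf.1 hx' Q ⟨hQ, h⟩
  rw [sInf_minPrimes, hR] at this
  simpa using this

/-- In a semiprime ring with finitely many minimal primes, a minimal prime is the left annihilator
of the intersection of the others. -/
theorem mem_minPrimes_iff_left (hR : IsSemiprimeRing R) (hfin : (minPrimes R).Finite)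
    (hP : P ∈ minPrimes R) (x : R) :
    x ∈ P ↔ ∀ y ∈ sInf (minPrimes R \ {P}), x * y = 0 := by
  refine ⟨fun hx y hy => eq_zero_of_mem_of_mem_sInf_diff hR
    (hP.1.isTwoSided.mul_mem_of_left y hx) (Ideal.mul_mem_left _ x hy), fun h => ?_⟩
  -- For y outside P in the intersection of the others, xRy = 0 ⊆ P forces x ∈ P.
  obtain ⟨y, hy, hyP⟩ := SetLike.not_le_iff_exists.1 (not_sInf_diff_le hfin hP)
  refine (hP.1.mem_or_mem fun r => ?_).resolve_right hyP
  rw [mul_assoc, h _ (Ideal.mul_mem_left _ r hy)]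
  exact P.zero_mem

theorem mem_minPrimes_iff_right (hR : IsSemiprimeRing R) (hfin : (minPrimes R).Finite)
    (hP : P ∈ minPrimes R) (x : R) :
    x ∈ P ↔ ∀ y ∈ sInf (minPrimes R \ {P}), y * x = 0 := by
  have h2 : (sInf (minPrimes R \ {P})).IsTwoSided :=
    isTwoSided_sInf fun I hI => hI.1.1.isTwoSided
  refine ⟨fun hx y hy => eq_zero_of_mem_of_mem_sInf_diff hR
    (P.mul_mem_left y hx) (h2.mul_mem_of_left x hy), fun h => ?_⟩
  obtain ⟨y, hy, hyP⟩ := SetLike.not_le_iff_exists.1 (not_sInf_diff_le hfin hP)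
  refine (hP.1.mem_or_mem fun r => ?_).resolve_left hyP
  rw [h _ (h2.mul_mem_of_left r hy)]
  exact P.zero_mem

/-- With P as a left annihilator, s * x * y = 0 and regularity of s give x * y = 0. -/
theorem mem_of_mul_mem_left (hR : IsSemiprimeRing R) (hfin : (minPrimes R).Finite)
    (hP : P ∈ minPrimes R) {s : R} (hs : s ∈ largestLeftDen R) {x : R} (h : s * x ∈ P) :
    x ∈ P := by
  rw [mem_minPrimes_iff_left hR hfin hP] at h ⊢
  exact fun y hy => mul_left_eq_zero_of_mem hs _ (by rw [← mul_assoc, h y hy])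

theorem mem_of_mul_mem_right (hR : IsSemiprimeRing R) (hfin : (minPrimes R).Finite)
    (hP : P ∈ minPrimes R) {s : R} (hs : s ∈ largestLeftDen R) {x : R} (h : x * s ∈ P) :
    x ∈ P := by
  rw [mem_minPrimes_iff_right hR hfin hP] at h ⊢
  exact fun y hy => mul_right_eq_zero_of_mem hs _ (by rw [mul_assoc, h y hy])

end Primes

/-! ### First isomorphism theorems -/

section Quotients

variable {A : Type*} [Ring A] {I : Ideal A} [I.IsTwoSided]

/-- The ideal is a variable so that the kernel equation can be substituted; in the application it is
a `localizedIdeal`. -/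
theorem exists_quotient_ringEquiv {B : Type*} [Ring B] (f : A →+* B)
    (hf : Function.Surjective f) (hI : RingHom.ker f = I) :
    ∃ e : (A ⧸ I) ≃+* B, ∀ x, e (Ideal.Quotient.mk I x) = f x := by
  subst hI
  exact ⟨RingHom.quotientKerEquivOfSurjective hf, fun _ => rfl⟩

theorem exists_quotient_ringHom_injective {B : Type*} [Ring B] (f : A →+* B)
    (hI : RingHom.ker f = I) :
    ∃ g : (A ⧸ I) →+* B, Function.Injective g ∧ ∀ x, g (Ideal.Quotient.mk I x) = f x := by
  subst hI
  exact ⟨RingHom.kerLift f, RingHom.kerLift_injective f, fun _ => rfl⟩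

theorem exists_quotient_linearEquiv {M : Type*} [AddCommGroup M] [Module A M] (m : M)
    (hm : ∀ y, ∃ a : A, a • m = y) (hI : ∀ a, a • m = 0 ↔ a ∈ I) :
    ∃ e : (A ⧸ I) ≃ₗ[A] M, ∀ a, e (Ideal.Quotient.mk I a) = a • m := by
  obtain rfl : LinearMap.ker (LinearMap.toSpanSingleton A M m) = I := by
    ext a
    simpa using hI a
  exact ⟨(LinearMap.toSpanSingleton A M m).quotKerEquivOfSurjective hm, fun _ => rfl⟩

end Quotients

/-! ### Localizing ideals and quotients at an Ore set -/

section Localization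

variable {R : Type u} [Ring R] {S : Submonoid R} [OreLocalization.OreSet S] {P : Ideal R}

open OreLocalization

/-- Membership is independent of the chosen fraction: clearing denominators gives v * a ∈ P with v ∈
S, and S cancels modulo P. -/
theorem oreDiv_mem_localizedIdeal_iff (hP : ∀ s ∈ S, ∀ x, s * x ∈ P → x ∈ P) (a : R) (s : S) :
    a /ₒ s ∈ localizedIdeal S P ↔ a ∈ P := by
  refine ⟨fun h => ?_, fun h => ⟨a, h, s, rfl⟩⟩
  have h1 : a /ₒ (1 : S) ∈ localizedIdeal S P := by
    have := (localizedIdeal S P).mul_mem_left ((s : R) /ₒ (1 : S)) h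
    rwa [OreLocalization.mul_cancel] at this
  obtain ⟨b, hb, t, e⟩ := h1
  obtain ⟨u, v, h1, h2⟩ := oreDiv_eq_iff.1 e
  have hv : v ∈ S := by
    have : v = u * t := by simpa using h2.symm
    rw [this]
    exact mul_mem u.2 t.2
  refine hP v hv a ?_
  rw [← smul_eq_mul, ← h1]
  exact P.mul_mem_left _ hb

/-- The middle factor ends in t, which cancels the second denominator, so no Ore condition is needed
to compute the product. -/
theorem oreDiv_mul_mul_oreDiv (a b r : R) (s t : S) :
    (a /ₒ s) * ((r /ₒ (1 : S)) * ((t : R) /ₒ (1 : S))) * (b /ₒ t) = (a * r * b) /ₒ s := by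
  rw [mul_assoc, mul_assoc, OreLocalization.mul_cancel, mul_div_one, mul_div_one, mul_assoc]

theorem isPrimeIdeal_localizedIdeal (hP : IsPrimeIdeal P)
    (hS : ∀ s ∈ S, ∀ x, s * x ∈ P → x ∈ P) (h2 : (localizedIdeal S P).IsTwoSided) :
    IsPrimeIdeal (localizedIdeal S P) := by
  refine .of_mem_or_mem h2 (fun h => hP.ne_top ?_) fun x y h => ?_
  · rw [Ideal.eq_top_iff_one, ← oreDiv_mem_localizedIdeal_iff hS 1 1, h]
    trivial
  · induction x with | _ a s
    induction y with | _ b t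
    rw [oreDiv_mem_localizedIdeal_iff hS, oreDiv_mem_localizedIdeal_iff hS]
    refine hP.mem_or_mem fun r => ?_
    rw [← oreDiv_mem_localizedIdeal_iff hS _ s, ← oreDiv_mul_mul_oreDiv a b r s t]
    exact h _

theorem IsSemiprimeRing.oreLocalization (hR : IsSemiprimeRing R)
    (hS : ∀ s ∈ S, ∀ x, s * x = 0 → x = 0) : IsSemiprimeRing (OreLocalization S R) := by
  rw [isSemiprimeRing_iff] at hR ⊢
  intro q hq
  induction q with | _ a s
  have hS' : ∀ s ∈ S, ∀ x, s * x ∈ (⊥ : Ideal R) → x ∈ (⊥ : Ideal R) := by simpa using hS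
  have ha : a = 0 := hR a fun r => by
    have h0 : (a * r * a) /ₒ s ∈ localizedIdeal S ⊥ := by
      rw [← oreDiv_mul_mul_oreDiv a a r s s, hq]
      exact Submodule.zero_mem _
    simpa using (oreDiv_mem_localizedIdeal_iff hS' _ s).1 h0
  rw [ha, zero_oreDiv]

theorem isTwoSided_localizedIdeal (h2 : P.IsTwoSided)
    (hS : ∀ s ∈ S, ∀ x, x * s ∈ P → x ∈ P) : (localizedIdeal S P).IsTwoSided := by
  refine ⟨fun {x} y hx => ?_⟩
  obtain ⟨a, ha, s, rfl⟩ := hx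
  induction y with | _ r t
  -- The Ore condition gives t' * a = a' * t, so a' * t ∈ P and right cancellation puts a' in P.
  obtain ⟨a', t', e, e'⟩ := oreDivMulChar' a r s t
  rw [e']
  refine ⟨_, h2.mul_mem_of_left r (hS t t.2 a' ?_), _, rfl⟩
  rw [← e]
  exact P.mul_mem_left _ ha

/-- The ring homomorphism `S⁻¹R → T⁻¹(R / P)`, `s⁻¹r ↦ π(s)⁻¹π(r)`. -/
noncomputable def quotientMap (P : Ideal R) [P.IsTwoSided] {T : Submonoid (R ⧸ P)} [OreSet T]
    (hT : S.map (Ideal.Quotient.mk P) ≤ T) :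
    OreLocalization S R →+* OreLocalization T (R ⧸ P) :=
  universalHom (numeratorRingHom.comp (Ideal.Quotient.mk P))
    { toFun := fun s => numeratorUnit
        (⟨Ideal.Quotient.mk P s, hT (Submonoid.mem_map_of_mem _ s.2)⟩ : T)
      map_one' := Units.ext (by simp [numeratorUnit, OreLocalization.one_def])
      map_mul' := fun a b => Units.ext (by simp [numeratorUnit, mul_div_one]) }
    fun s => rfl

section Map

variable [P.IsTwoSided] {T : Submonoid (R ⧸ P)} [OreSet T]
  (hT : S.map (Ideal.Quotient.mk P) ≤ T)

theorem quotientMap_oreDiv (r : R) (s : S) :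
    quotientMap P hT (r /ₒ s) = Ideal.Quotient.mk P r /ₒ
      (⟨Ideal.Quotient.mk P s, hT (Submonoid.mem_map_of_mem _ s.2)⟩ : T) := by
  refine (universalHom_apply _ _ _).trans ?_
  change (1 /ₒ _) * (_ /ₒ 1) = _
  rw [mul_div_one, one_mul]

theorem ker_quotientMap (hTreg : ∀ t ∈ T, ∀ x, t * x = 0 → x = 0) :
    RingHom.ker (quotientMap P hT) = localizedIdeal S P := by
  ext x
  rw [RingHom.mem_ker]
  constructor
  · intro hx
    induction x with | _ a s
    refine ⟨a, ?_, s, rfl⟩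
    rw [quotientMap_oreDiv] at hx
    have hT' : ∀ t ∈ T, ∀ x, t * x ∈ (⊥ : Ideal (R ⧸ P)) → x ∈ (⊥ : Ideal (R ⧸ P)) := by
      simpa using hTreg
    have := (oreDiv_mem_localizedIdeal_iff hT' (Ideal.Quotient.mk P a) _).1
      (hx ▸ Submodule.zero_mem _)
    rwa [Submodule.mem_bot, Ideal.Quotient.eq_zero_iff_mem] at this
  · rintro ⟨a, ha, s, rfl⟩
    rw [quotientMap_oreDiv, Ideal.Quotient.eq_zero_iff_mem.2 ha, zero_oreDiv]

end Map

theorem quotientMap_surjective [P.IsTwoSided] [OreSet (S.map (Ideal.Quotient.mk P))] :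
    Function.Surjective (quotientMap (S := S) P le_rfl) := fun y => by
  induction y with | _ r t
  obtain ⟨_, s, hs, rfl⟩ := t
  obtain ⟨r, rfl⟩ := Ideal.Quotient.mk_surjective r
  exact ⟨r /ₒ (⟨s, hs⟩ : S), quotientMap_oreDiv le_rfl r ⟨s, hs⟩⟩

theorem oreDiv_smul_mk_one [P.IsTwoSided] (r : R) (s : S) :
    (r /ₒ s) • ((1 : R ⧸ P) /ₒ (1 : S)) = Ideal.Quotient.mk P r /ₒ s := by
  rw [smul_div_one]
  congr 1
  rw [← map_one (Ideal.Quotient.mk P)]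
  change Ideal.Quotient.mk P (r * 1) = _
  rw [mul_one]

theorem mk_oreDiv_eq_zero_iff [P.IsTwoSided] (hS : ∀ s ∈ S, ∀ x, s * x ∈ P → x ∈ P)
    (r : R) (s : S) : Ideal.Quotient.mk P r /ₒ s = 0 ↔ r ∈ P := by
  refine ⟨fun h => ?_, fun h => by rw [Ideal.Quotient.eq_zero_iff_mem.2 h, zero_oreDiv]⟩
  have h1 : Ideal.Quotient.mk P r /ₒ (1 : S) = 0 /ₒ (1 : S) := by
    rw [← OreLocalization.smul_cancel (s := s) (t := 1), h, OreLocalization.smul_zero,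
      zero_oreDiv]
  obtain ⟨u, v, h1, h2⟩ := oreDiv_eq_iff.1 h1
  rw [smul_zero] at h1
  have hv : v = u := by simpa using h2.symm
  exact hS u u.2 r (hv ▸ Ideal.Quotient.eq_zero_iff_mem.1 h1.symm)

/-- S⁻¹(R/P) is cyclic, generated by 1/1, whose annihilator is S⁻¹P. -/
theorem exists_linearEquiv_quotient_localizedIdeal [P.IsTwoSided]
    [(localizedIdeal S P).IsTwoSided] (hS : ∀ s ∈ S, ∀ x, s * x ∈ P → x ∈ P) :
    ∃ e : (OreLocalization S R ⧸ localizedIdeal S P) ≃ₗ[OreLocalization S R]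
        OreLocalization S (R ⧸ P),
      ∀ (r : R) (s : S), e (Ideal.Quotient.mk _ (r /ₒ s)) = Ideal.Quotient.mk P r /ₒ s := by
  obtain ⟨e, he⟩ := exists_quotient_linearEquiv (A := OreLocalization S R)
    (I := localizedIdeal S P) ((1 : R ⧸ P) /ₒ (1 : S))
    (fun y => by
      induction y with | _ r s
      obtain ⟨r, rfl⟩ := Ideal.Quotient.mk_surjective r
      exact ⟨r /ₒ s, oreDiv_smul_mk_one r s⟩)
    (fun x => by
      induction x with | _ r s
      rw [oreDiv_smul_mk_one, mk_oreDiv_eq_zero_iff hS, oreDiv_mem_localizedIdeal_iff hS])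
  exact ⟨e, fun r s => (he _).trans (oreDiv_smul_mk_one r s)⟩

end Localization

/-! ### Minimal primes of the largest left quotient ring -/

section MinimalPrimes

variable {R : Type u} [Ring R] {P : Ideal R}

theorem isPrimeIdeal_localizedIdeal_of_mem_minPrimes (hR : IsSemiprimeRing R)
    (hfin : (minPrimes R).Finite) (hP : P ∈ minPrimes R) :
    IsPrimeIdeal (localizedIdeal (largestLeftDen R) P) :=
  isPrimeIdeal_localizedIdeal hP.1 (fun _ hs _ => mem_of_mul_mem_left hR hfin hP hs)
    (isTwoSided_localizedIdeal hP.1.isTwoSided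
      fun _ hs _ => mem_of_mul_mem_right hR hfin hP hs)

theorem sInf_image_localizedIdeal (hR : IsSemiprimeRing R) (hfin : (minPrimes R).Finite) :
    sInf (localizedIdeal (largestLeftDen R) '' minPrimes R) = ⊥ := by
  refine (Submodule.eq_bot_iff _).2 fun x hx => ?_
  induction x with | _ a s
  have ha : a ∈ sInf (minPrimes R) := Submodule.mem_sInf.2 fun P hP =>
    (oreDiv_mem_localizedIdeal_iff (fun _ hs _ => mem_of_mul_mem_left hR hfin hP hs) a s).1
      (Submodule.mem_sInf.1 hx _ ⟨P, hP, rfl⟩)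
  rw [sInf_minPrimes, hR, Submodule.mem_bot] at ha
  rw [ha, OreLocalization.zero_oreDiv]

theorem exists_localizedIdeal_le (hR : IsSemiprimeRing R) (hfin : (minPrimes R).Finite)
    {Q : Ideal (LargestLeftQuotientRing R)} (hQ : IsPrimeIdeal Q) :
    ∃ P ∈ minPrimes R, localizedIdeal (largestLeftDen R) P ≤ Q := by
  obtain ⟨_, ⟨P, hP, rfl⟩, hle⟩ := hQ.exists_le_of_sInf_le (hfin.image _)
    (by
      rintro _ ⟨P, hP, rfl⟩
      exact (isPrimeIdeal_localizedIdeal_of_mem_minPrimes hR hfin hP).isTwoSided)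
    ((sInf_image_localizedIdeal hR hfin).trans_le bot_le)
  exact ⟨P, hP, hle⟩

theorem minPrimes_largestLeftQuotientRing (hR : IsSemiprimeRing R)
    (hfin : (minPrimes R).Finite) :
    minPrimes (LargestLeftQuotientRing R) =
      {q | ∃ P ∈ minPrimes R, q = localizedIdeal (largestLeftDen R) P} := by
  ext Q
  constructor
  · intro hQ
    obtain ⟨P, hP, hle⟩ := exists_localizedIdeal_le hR hfin hQ.1
    exact ⟨P, hP, (eq_of_le_of_mem_minPrimes
      (isPrimeIdeal_localizedIdeal_of_mem_minPrimes hR hfin hP) hQ hle).symm⟩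
  · rintro ⟨P, hP, rfl⟩
    refine ⟨isPrimeIdeal_localizedIdeal_of_mem_minPrimes hR hfin hP, fun Q hQ hQP => ?_⟩
    obtain ⟨P', hP', hle⟩ := exists_localizedIdeal_le hR hfin hQ
    -- Contracting S⁻¹P' ≤ S⁻¹P to R gives P' ≤ P, hence equality.
    have hPP : P' ≤ P := fun a ha =>
      (oreDiv_mem_localizedIdeal_iff (fun _ hs _ => mem_of_mul_mem_left hR hfin hP hs) a 1).1
        (hQP (hle ⟨a, ha, 1, rfl⟩))
    rwa [eq_of_le_of_mem_minPrimes hP'.1 hP hPP] at hle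

theorem map_largestLeftDen_mem_leftDen [P.IsTwoSided] (hR : IsSemiprimeRing R)
    (hfin : (minPrimes R).Finite) (hP : P ∈ minPrimes R) :
    (largestLeftDen R).map (Ideal.Quotient.mk P) ∈ leftDen (R ⧸ P) ⊥ := by
  refine ⟨⟨⟨?_, ?_⟩, ?_⟩, ?_⟩
  · rintro ⟨s, hs, h0⟩
    refine hP.1.ne_top ((Ideal.eq_top_iff_one P).2 (mem_of_mul_mem_left hR hfin hP hs ?_))
    rw [mul_one]
    exact Ideal.Quotient.eq_zero_iff_mem.1 h0
  · rintro r _ ⟨s, hs, rfl⟩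
    obtain ⟨r, rfl⟩ := Ideal.Quotient.mk_surjective r
    obtain ⟨t, ht, r', e⟩ := largestLeftDen_ore hs r
    exact ⟨_, ⟨t, ht, rfl⟩, Ideal.Quotient.mk P r', by
      simpa only [map_mul] using congrArg (Ideal.Quotient.mk P) e⟩
  · rintro r _ ⟨s, hs, rfl⟩ h
    obtain ⟨r, rfl⟩ := Ideal.Quotient.mk_surjective r
    refine ⟨1, one_mem _, ?_⟩
    rw [one_mul, Ideal.Quotient.eq_zero_iff_mem]
    refine mem_of_mul_mem_right hR hfin hP hs (Ideal.Quotient.eq_zero_iff_mem.1 ?_)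
    simpa using h
  · ext r
    constructor
    · rintro ⟨_, ⟨s, hs, rfl⟩, h⟩
      obtain ⟨r, rfl⟩ := Ideal.Quotient.mk_surjective r
      refine Ideal.Quotient.eq_zero_iff_mem.2 (mem_of_mul_mem_left hR hfin hP hs
        (Ideal.Quotient.eq_zero_iff_mem.1 ?_))
      simpa using h
    · intro h
      exact ⟨1, one_mem _, by simpa using h⟩

end MinimalPrimes

end LargestLeft

theorem mainTheorem8 {R : Type*} [Ring R] [Nontrivial R] (hR : IsSemiprimeRing R) :
    IsSemiprimeRing (LargestLeftQuotientRing R) ∧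
    ((minPrimes R).Finite →
      minPrimes (LargestLeftQuotientRing R) =
          {q | ∃ 𝔭 ∈ minPrimes R, q = localizedIdeal (largestLeftDen R) 𝔭} ∧
      ∀ (𝔭 : Ideal R) [𝔭.IsTwoSided], 𝔭 ∈ minPrimes R →
        ∃ hden : (largestLeftDen R).map (Ideal.Quotient.mk 𝔭) ∈ leftDen (R ⧸ 𝔭) ⊥,
        ∃ hle : (largestLeftDen R).map (Ideal.Quotient.mk 𝔭) ≤ largestLeftDen (R ⧸ 𝔭),
        ∃ _ : (localizedIdeal (largestLeftDen R) 𝔭).IsTwoSided,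
          -- the ring `Q_l(R) / S_l(R)⁻¹𝔭` is `π(S_l(R))⁻¹(R / 𝔭)`
          (letI : OreLocalization.OreSet ((largestLeftDen R).map (Ideal.Quotient.mk 𝔭)) :=
              hden.1.oreSet
            ∃ e : (LargestLeftQuotientRing R ⧸ localizedIdeal (largestLeftDen R) 𝔭) ≃+*
                OreLocalization ((largestLeftDen R).map (Ideal.Quotient.mk 𝔭)) (R ⧸ 𝔭),
              ∀ (r : R) (s : largestLeftDen R),
                e (Ideal.Quotient.mk _ (OreLocalization.oreDiv r s)) =
                  OreLocalization.oreDiv (Ideal.Quotient.mk 𝔭 r)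
                    ⟨Ideal.Quotient.mk 𝔭 s, Submonoid.mem_map_of_mem _ s.2⟩) ∧
          -- the left `Q_l(R)`-module `Q_l(R) / S_l(R)⁻¹𝔭` is `S_l(R)⁻¹(R / 𝔭)`
          (∃ e : (LargestLeftQuotientRing R ⧸ localizedIdeal (largestLeftDen R) 𝔭)
                ≃ₗ[LargestLeftQuotientRing R] OreLocalization (largestLeftDen R) (R ⧸ 𝔭),
              ∀ (r : R) (s : largestLeftDen R),
                e (Ideal.Quotient.mk _ (OreLocalization.oreDiv r s)) =
                  OreLocalization.oreDiv (Ideal.Quotient.mk 𝔭 r) s) ∧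
          -- the ring `Q_l(R) / S_l(R)⁻¹𝔭` embeds naturally in `Q_l(R / 𝔭)`
          (∃ f : (LargestLeftQuotientRing R ⧸ localizedIdeal (largestLeftDen R) 𝔭) →+*
                LargestLeftQuotientRing (R ⧸ 𝔭),
              Function.Injective f ∧
              ∀ (r : R) (s : largestLeftDen R),
                f (Ideal.Quotient.mk _ (OreLocalization.oreDiv r s)) =
                  OreLocalization.oreDiv (Ideal.Quotient.mk 𝔭 r)
                    ⟨Ideal.Quotient.mk 𝔭 s, hle (Submonoid.mem_map_of_mem _ s.2)⟩)) := by
  refine ⟨hR.oreLocalization fun s hs => mul_left_eq_zero_of_mem hs,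
    fun hfin => ⟨minPrimes_largestLeftQuotientRing hR hfin, fun 𝔭 _ h𝔭 => ?_⟩⟩
  have hden := map_largestLeftDen_mem_leftDen hR hfin h𝔭
  have hle : (largestLeftDen R).map (Ideal.Quotient.mk 𝔭) ≤ largestLeftDen (R ⧸ 𝔭) :=
    le_sSup hden
  have h2 : (localizedIdeal (largestLeftDen R) 𝔭).IsTwoSided :=
    (isPrimeIdeal_localizedIdeal_of_mem_minPrimes hR hfin h𝔭).isTwoSided
  have hreg : ∀ s ∈ largestLeftDen R, ∀ x, s * x ∈ 𝔭 → x ∈ 𝔭 :=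
    fun s hs x => mem_of_mul_mem_left hR hfin h𝔭 hs
  have hregT : ∀ t ∈ largestLeftDen (R ⧸ 𝔭), ∀ x, t * x = 0 → x = 0 :=
    fun t ht => mul_left_eq_zero_of_mem ht
  refine ⟨hden, hle, h2, ?_, ?_, ?_⟩
  · let : OreLocalization.OreSet ((largestLeftDen R).map (Ideal.Quotient.mk 𝔭)) :=
      hden.1.oreSet
    obtain ⟨e, he⟩ := exists_quotient_ringEquiv (quotientMap 𝔭 le_rfl) quotientMap_surjective
      (ker_quotientMap le_rfl fun t ht => hregT t (hle ht))
    exact ⟨e, fun r s => (he _).trans (quotientMap_oreDiv le_rfl r s)⟩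
  · exact exists_linearEquiv_quotient_localizedIdeal hreg
  · obtain ⟨f, hf, hf'⟩ := exists_quotient_ringHom_injective (quotientMap 𝔭 hle)
      (ker_quotientMap hle hregT)
    exact ⟨f, hf, fun r s => (hf' _).trans (quotientMap_oreDiv hle r s)⟩
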